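/- For a finite group $X$ let $\rho(X)=\prod_{x\in X} o(x)$ be the product of the orders of its elements, and let $C_n$ be the cyclic group of order $n$. Let $G$ be a Frobenius group with Frobenius complement $H$, that is, $G$ is a finite group and $H$ is a subgroup with $1\neq H\neq G$ such that $H\cap H^x=1$ for all $x\in G\setminus H$, where $H^x=x^{-1}Hx$. Let $$N=G\setminus\bigcup_{x\in G}(H\setminus\{1\})^x$$ be the Frobenius kernel (a normal subgroup of $G$ by a theorem of Frobenius), and put $\rho(N)=\prod_{x\in N}o(x)$. Then $$\rho(G)=\rho(N)\,\rho(H)^{|N|}.$$ In particular, if $G$ has order $n$ and $q$ is the smallest prime dividing $n$, then $$\rho(G)\le q^{-q}\,\rho(C_n).$$ -/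

import Mathlib

/-- The product of the element orders of a finite group `G`. -/
noncomputable def rho (G : Type*) [Group G] : ℕ := ∏ᶠ g : G, orderOf g

/-- `H` is a Frobenius complement in `G`: a nontrivial proper subgroup that meets each of its
conjugates `H ^ x = x⁻¹ H x` with `x ∉ H` trivially. A finite group that has such a subgroup
is a Frobenius group. -/
structure IsFrobeniusComplement {G : Type*} [Group G] (H : Subgroup G) : Prop where
  ne_bot : H ≠ ⊥
  ne_top : H ≠ ⊤
  inf_conj_eq_bot : ∀ x : G, x ∉ H → H ⊓ H.map (MulAut.conj x⁻¹).toMonoidHom = ⊥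

/-- The Frobenius kernel belonging to `H`, as a set: the elements of `G` lying in no conjugate
`x⁻¹ (H \ {1}) x`. -/
def frobeniusKernel {G : Type*} [Group G] (H : Subgroup G) : Set G :=
  Set.univ \ ⋃ x : G, (fun h : G => x⁻¹ * h * x) '' ((H : Set G) \ {1})

/-! Write `m` for the index of `H`, `h` for its order and `n = m h`. The `m` conjugates of `H` meet
pairwise trivially, so the complement of the kernel `N` is a disjoint union of `m` copies of `H \
{1}`; this gives the product formula and `|N| = m`.

For the bound, `H` contains a Sylow `p`-subgroup of `G` for each prime `p ∣ h`. So `m` and `h` are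
coprime, and `N` consists of the elements of order dividing `m` (`mem_frobeniusKernel_iff`).
Frobenius' theorem gives at least `d` solutions of `x ^ d = 1` in `N` for each `d ∣ m`, whence `ρ(N)
≤ ρ(C_m)` by `prod_orderOf_le_rho_zmod`, without using that `N` is a subgroup. Similarly `ρ(H) ≤
ρ(C_h)`. As `ρ(C_n) = ρ(C_m) ^ h * ρ(C_h) ^ m`, a factor `ρ(C_m) ^ (h - 1) ≥ q ^ ((m - 1) * (h - 1))
≥ q ^ q` is left over. -/

section Frobenius

open Finset

/-! ### Frobenius' theorem on `x ^ n = 1` -/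

theorem card_filter_zpowers_eq {G : Type*} [Group G] [Fintype G] (x : G)
    [DecidablePred fun y : G => Subgroup.zpowers y = Subgroup.zpowers x] :
    #{y : G | Subgroup.zpowers y = Subgroup.zpowers x} = (orderOf x).totient := by
  classical
  rw [Nat.totient_eq_card_coprime]
  rw [← card_image_of_injOn (s := {k ∈ range (orderOf x) | (orderOf x).Coprime k})
    (f := fun k => x ^ k)]
  · congr 1
    ext y
    simp only [mem_filter, mem_univ, true_and, mem_image, mem_range]
    constructor
    · intro h
      have hy : y ∈ Subgroup.zpowers x := h ▸ Subgroup.mem_zpowers y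
      obtain ⟨k, hk, rfl⟩ := (mem_zpowers_iff_mem_range_orderOf.1 hy |> mem_image.1)
      refine ⟨k, ⟨mem_range.1 hk, ?_⟩, rfl⟩
      have ho : orderOf (x ^ k) = orderOf x := by
        rw [← Nat.card_zpowers, h, Nat.card_zpowers]
      rw [orderOf_pow] at ho
      have hpos := orderOf_pos x
      exact (Nat.div_eq_self.1 ho).resolve_left hpos.ne'
    · rintro ⟨k, ⟨-, hk⟩, rfl⟩
      apply Subgroup.eq_of_le_of_card_ge
      · exact Subgroup.zpowers_le.2 (Subgroup.npow_mem_zpowers x k)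
      · rw [Nat.card_zpowers, Nat.card_zpowers, hk.orderOf_pow]
  · intro a ha b hb hab
    simp only [coe_filter, mem_range, Set.mem_ofPred_eq] at ha hb
    exact pow_injOn_Iio_orderOf ha.1 hb.1 hab

/-- `T` splits into the full generator sets of cyclic subgroups, each of size `φ(o(x))`. -/
theorem dvd_card_of_dvd_totient_orderOf {G : Type*} [Group G] [Fintype G] {T : Finset G} {k : ℕ}
    (hT : ∀ x ∈ T, ∀ y, Subgroup.zpowers y = Subgroup.zpowers x → y ∈ T)
    (hk : ∀ x ∈ T, k ∣ (orderOf x).totient) : k ∣ #T := by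
  classical
  rw [card_eq_sum_card_image (fun x => Subgroup.zpowers x) T]
  refine dvd_sum fun C hC => ?_
  obtain ⟨x, hx, rfl⟩ := mem_image.1 hC
  have : {y ∈ T | Subgroup.zpowers y = Subgroup.zpowers x} =
      ({y : G | Subgroup.zpowers y = Subgroup.zpowers x} : Finset G) := by
    ext y
    simpa using hT x hx y
  rw [this, card_filter_zpowers_eq]
  exact hk x hx

theorem dvd_sum_of_isConj_invariant {G : Type*} [Group G] [Fintype G] {Y : Finset G} {c : G → ℕ}
    {k : ℕ} (hY : ∀ x ∈ Y, ∀ y, IsConj x y → y ∈ Y) (hc : ∀ x y, IsConj x y → c x = c y)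
    (hk : ∀ y ∈ Y, k ∣ (Subgroup.centralizer {y}).index * c y) : k ∣ ∑ y ∈ Y, c y := by
  classical
  rw [← sum_fiberwise_of_maps_to (t := Y.image ConjClasses.mk) (g := ConjClasses.mk)
    (fun x hx => mem_image_of_mem _ hx)]
  refine dvd_sum fun C hC => ?_
  obtain ⟨y, hy, rfl⟩ := mem_image.1 hC
  have h1 : ∑ x ∈ Y with ConjClasses.mk x = ConjClasses.mk y, c x =
      ∑ x ∈ Y with ConjClasses.mk x = ConjClasses.mk y, c y := by
    refine sum_congr rfl fun x hx => hc _ _ ?_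
    exact ConjClasses.mk_eq_mk_iff_isConj.1 (mem_filter.1 hx).2
  have h2 : #{x ∈ Y | ConjClasses.mk x = ConjClasses.mk y} =
      (Subgroup.centralizer {y}).index := by
    have h3 : (Subgroup.centralizer {y}).index = (MulAction.orbit (ConjAct G) y).ncard := by
      rw [← MulAction.index_stabilizer]
      rw [ConjAct.stabilizer_eq_centralizer]
      rfl
    rw [h3, ← Set.ncard_coe_finset]
    congr 1
    ext x
    rw [ConjAct.mem_orbit_conjAct, coe_filter, Set.mem_ofPred_eq,
      ConjClasses.mk_eq_mk_iff_isConj]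
    exact ⟨fun h => h.2, fun h => ⟨hY y hy x h.symm, h⟩⟩
  rw [h1, sum_const, h2, smul_eq_mul]
  exact hk y hy

/-- Since `⟨y⟩` is central of order prime to `r`, each solution in the quotient has exactly one lift
that is a solution: `c ^ s` for any lift `c`, where `s ≡ 0` mod `o(y)` and `s ≡ 1` mod `r`. -/
theorem card_pow_eq_one_quotient_zpowers {C : Type*} [Group C] {y : C}
    [(Subgroup.zpowers y).Normal] (hy : ∀ z, Commute y z) {r : ℕ}
    (hr : (orderOf y).Coprime r) :
    Nat.card {z : C // z ^ r = 1} = Nat.card {q : C ⧸ Subgroup.zpowers y // q ^ r = 1} := by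
  obtain ⟨s, hs, hs'⟩ := Nat.chineseRemainder hr 0 1
  have hys : y ^ s = 1 := orderOf_dvd_iff_pow_eq_one.1 ((Nat.modEq_zero_iff_dvd).1 hs)
  have hpow : ∀ {K : Type _} [Group K] (z : K), z ^ r = 1 → z ^ s = z := by
    intro K _ z hz
    have : z ^ s = z ^ 1 := by
      rw [pow_eq_pow_iff_modEq]
      exact hs'.of_dvd (orderOf_dvd_of_pow_eq_one hz)
    simpa using this
  refine Nat.card_eq_of_bijective
    (fun z => ⟨(z.1 : C ⧸ Subgroup.zpowers y), by
      rw [← QuotientGroup.mk_pow, z.2, QuotientGroup.mk_one]⟩) ⟨?_, ?_⟩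
  · rintro ⟨z, hz⟩ ⟨w, hw⟩ h
    have h' : (z : C ⧸ Subgroup.zpowers y) = w := congrArg Subtype.val h
    obtain ⟨k, hk⟩ := Subgroup.mem_zpowers_iff.1 (QuotientGroup.eq.1 h')
    have hw' : w = z * y ^ k := by rw [hk]; group
    apply Subtype.ext
    change z = w
    have hcomm : Commute z (y ^ k) := ((hy z).zpow_left k).symm
    have h3 : (z * y ^ k) ^ s = z := by
      rw [hcomm.mul_pow, hpow z hz, ← zpow_natCast (y ^ k), ← zpow_mul, mul_comm k, zpow_mul,
        zpow_natCast, hys, one_zpow, mul_one]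
    rw [← hpow w hw, hw', h3]
  · rintro ⟨q, hq⟩
    obtain ⟨c, rfl⟩ := QuotientGroup.mk_surjective q
    have hc : c ^ r ∈ Subgroup.zpowers y := by
      rwa [← QuotientGroup.mk_pow, QuotientGroup.eq_one_iff] at hq
    obtain ⟨k, hk⟩ := Subgroup.mem_zpowers_iff.1 hc
    refine ⟨⟨c ^ s, ?_⟩, ?_⟩
    · rw [← pow_mul, mul_comm, pow_mul, ← hk, ← zpow_natCast, ← zpow_mul, mul_comm k, zpow_mul,
        zpow_natCast, hys, one_zpow]
    · apply Subtype.ext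
      change ((c ^ s : C) : C ⧸ Subgroup.zpowers y) = c
      rw [QuotientGroup.mk_pow, hpow _ hq]

/-- The bijection is `z ↦ y * z`. In the application `r` is prime to `o(y)`, and `x ↦ x ^ u`
extracts the `p`-part of `x`. -/
theorem card_centralizer_pow_eq_one {G : Type*} [Group G] {y : G} {r u : ℕ}
    (hyu : u ≡ 1 [MOD orderOf y]) (hru : r ∣ u) :
    Nat.card {z : Subgroup.centralizer {y} // z ^ r = 1} =
      Nat.card {x : G // x ^ (orderOf y * r) = 1 ∧ x ^ u = y} := by
  have hcent : ∀ z : Subgroup.centralizer {y}, Commute y z.1 := fun z =>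
    (Subgroup.mem_centralizer_singleton_iff.1 z.2).symm
  have hyu' : y ^ u = y := by
    have : y ^ u = y ^ 1 := pow_eq_pow_iff_modEq.2 hyu
    simpa using this
  refine Nat.card_eq_of_bijective (fun z => ⟨y * z.1.1, ?_, ?_⟩) ⟨?_, ?_⟩
  · have hz : (z.1.1 : G) ^ r = 1 := congrArg Subtype.val z.2
    rw [(hcent z.1).mul_pow, pow_mul, pow_orderOf_eq_one, one_pow, one_mul, mul_comm, pow_mul,
      hz, one_pow]
  · have hz : (z.1.1 : G) ^ r = 1 := congrArg Subtype.val z.2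
    obtain ⟨v, rfl⟩ := hru
    rw [(hcent z.1).mul_pow, hyu', pow_mul (z.1.1 : G), hz, one_pow, mul_one]
  · intro z w h
    have h' : y * z.1.1 = y * w.1.1 := congrArg Subtype.val h
    exact Subtype.ext (Subtype.ext (mul_left_cancel h'))
  · rintro ⟨x, hx, hxy⟩
    have hcomm : Commute y x := hxy ▸ (Commute.refl x).pow_left u
    have hmem : y⁻¹ * x ∈ Subgroup.centralizer {y} := by
      rw [Subgroup.mem_centralizer_singleton_iff]
      exact ((Commute.refl y).inv_right.mul_right hcomm).symm
    refine ⟨⟨⟨y⁻¹ * x, hmem⟩, ?_⟩, ?_⟩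
    · apply Subtype.ext
      change (y⁻¹ * x) ^ r = 1
      have hxr : x ^ (u * r) = x ^ r := by
        rw [pow_eq_pow_iff_modEq]
        have h1 : u * r ≡ 1 * r [MOD orderOf y * r] := hyu.mul_right' r
        rw [one_mul] at h1
        exact h1.of_dvd (orderOf_dvd_of_pow_eq_one hx)
      rw [hcomm.inv_left.mul_pow, inv_pow, inv_mul_eq_one, ← hxr, pow_mul, hxy]
    · apply Subtype.ext
      change y * (y⁻¹ * x) = x
      simp

theorem card_centralizer_pow_eq_one_of_isConj {G : Type*} [Group G] {x y : G} (r : ℕ)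
    (h : IsConj x y) :
    Nat.card {z : Subgroup.centralizer {x} // z ^ r = 1} =
      Nat.card {z : Subgroup.centralizer {y} // z ^ r = 1} := by
  obtain ⟨g, rfl⟩ := isConj_iff.1 h
  have e : Subgroup.centralizer {x} ≃* Subgroup.centralizer {g * x * g⁻¹} :=
    ((MulAut.conj g).subgroupMap _).trans (MulEquiv.subgroupCongr (by
      ext z
      refine Subgroup.mem_map_equiv.trans ?_
      rw [Subgroup.mem_centralizer_singleton_iff,
        Subgroup.mem_centralizer_singleton_iff, ← (MulAut.conj g).injective.eq_iff]
      simp [mul_assoc]))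
  exact Nat.card_congr (e.toEquiv.subtypeEquiv fun z => by
    rw [← map_eq_one_iff e e.injective, map_pow]; rfl)

/-- The coprime factors are treated separately: `p ^ e` divides `φ(o(x))` for every `x` counted,
while `r` comes from sorting the `x` by their `p`-part `y` and grouping the `y` into conjugacy
classes. -/
theorem dvd_card_pow_eq_one_step {G : Type*} [Group G] [Fintype G] [DecidableEq G] {p e r u : ℕ}
    (hp : p.Prime) (hpr : p.Coprime r) (hu1 : u ≡ 1 [MOD p ^ (e + 1)]) (hru : r ∣ u)
    (hr : ∀ y : G, orderOf y = p ^ (e + 1) → r ∣ (Subgroup.centralizer {y}).index *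
      Nat.card {z : Subgroup.centralizer {y} // z ^ r = 1}) :
    p ^ e * r ∣ #{x : G | x ^ (p ^ (e + 1) * r) = 1 ∧ orderOf (x ^ u) = p ^ (e + 1)} := by
  refine (hpr.pow_left e).mul_dvd_of_dvd_of_dvd ?_ ?_
  · refine dvd_card_of_dvd_totient_orderOf ?_ ?_
    · intro x hx y hxy
      simp only [mem_filter, mem_univ, true_and] at hx ⊢
      have ho : orderOf y = orderOf x := by rw [← Nat.card_zpowers, hxy, Nat.card_zpowers]
      rw [← orderOf_dvd_iff_pow_eq_one, orderOf_pow, ho, ← orderOf_pow,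
        orderOf_dvd_iff_pow_eq_one]
      exact hx
    · intro x hx
      simp only [mem_filter, mem_univ, true_and] at hx
      have h1 : p ^ (e + 1) ∣ orderOf x := hx.2 ▸ orderOf_pow_dvd u
      refine dvd_trans ?_ (Nat.totient_dvd_of_dvd h1)
      rw [Nat.totient_prime_pow_succ hp]
      exact dvd_mul_right _ _
  · have h1 : #{x : G | x ^ (p ^ (e + 1) * r) = 1 ∧ orderOf (x ^ u) = p ^ (e + 1)} =
        ∑ y : G with orderOf y = p ^ (e + 1),
          Nat.card {z : Subgroup.centralizer {y} // z ^ r = 1} := by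
      rw [card_eq_sum_card_fiberwise (f := fun x => x ^ u)
        (t := {y : G | orderOf y = p ^ (e + 1)}) (fun x hx => by simp_all)]
      refine sum_congr rfl fun y hy => ?_
      have hy : orderOf y = p ^ (e + 1) := by simpa using hy
      rw [card_centralizer_pow_eq_one (u := u) (by rwa [hy]) hru, Nat.card_eq_fintype_card,
        Fintype.card_subtype, filter_filter]
      congr 1
      ext x
      simp only [mem_filter, mem_univ, true_and, hy]
      exact ⟨fun h => ⟨h.1.1, h.2⟩, fun h => ⟨⟨h.1, h.2 ▸ hy⟩, h.2⟩⟩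
    rw [h1]
    refine dvd_sum_of_isConj_invariant ?_ (fun x y h => card_centralizer_pow_eq_one_of_isConj r h)
      (fun y hy => hr y (by simpa using hy))
    intro x hx y hxy
    obtain ⟨g, rfl⟩ := isConj_iff.1 hxy
    simp only [mem_filter, mem_univ, true_and] at hx ⊢
    rw [← hx]
    exact (MulAut.conj g).orderOf_eq x

theorem card_pow_eq_one_succ {G : Type*} [Group G] [Fintype G] [DecidableEq G] {p e r u : ℕ}
    (hp : p.Prime) (hu1 : u ≡ 1 [MOD p ^ (e + 1)]) (hru : r ∣ u) :
    #{x : G | x ^ (p ^ (e + 1) * r) = 1} = #{x : G | x ^ (p ^ e * r) = 1} +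
      #{x : G | x ^ (p ^ (e + 1) * r) = 1 ∧ orderOf (x ^ u) = p ^ (e + 1)} := by
  rw [← card_filter_add_card_filter_not (s := {x : G | x ^ (p ^ (e + 1) * r) = 1})
    (fun x => x ^ (p ^ e * r) = 1), filter_filter, filter_filter]
  congr 2
  · ext x
    simp only [mem_filter, mem_univ, true_and, and_iff_right_iff_imp]
    intro h
    rw [pow_succ, mul_right_comm, pow_mul, h, one_pow]
  · ext x
    simp only [mem_filter, mem_univ, true_and]
    refine and_congr_right fun hx => ?_
    have hdvd : orderOf (x ^ u) ∣ p ^ (e + 1) := by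
      obtain ⟨v, rfl⟩ := hru
      rw [orderOf_dvd_iff_pow_eq_one, ← pow_mul, mul_right_comm, mul_comm r, pow_mul, hx, one_pow]
    have hiff : x ^ (p ^ e * r) = 1 ↔ orderOf (x ^ u) ∣ p ^ e := by
      rw [orderOf_dvd_iff_pow_eq_one, ← pow_mul]
      constructor
      · intro h
        obtain ⟨v, rfl⟩ := hru
        rw [mul_right_comm, mul_comm r, pow_mul, h, one_pow]
      · intro h
        have hxr : x ^ (u * r) = x ^ r := by
          rw [pow_eq_pow_iff_modEq]
          have h1 : u * r ≡ 1 * r [MOD p ^ (e + 1) * r] := hu1.mul_right' r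
          rw [one_mul] at h1
          exact h1.of_dvd (orderOf_dvd_of_pow_eq_one hx)
        rw [mul_comm, pow_mul, ← hxr, ← pow_mul, mul_right_comm, pow_mul, h, one_pow]
    rw [hiff]
    constructor
    · intro h
      obtain ⟨k, hk, hk'⟩ := (Nat.dvd_prime_pow hp).1 hdvd
      rcases hk.lt_or_eq with hlt | rfl
      · exact absurd (hk' ▸ pow_dvd_pow p (Nat.lt_succ_iff.1 hlt)) h
      · exact hk'
    · intro h h'
      rw [h] at h'
      have := (Nat.pow_dvd_pow_iff_le_right hp.one_lt).1 h'
      omega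

/-- **Frobenius' theorem** on the number of solutions of `x ^ n = 1` in a finite group. -/
theorem gcd_card_dvd_card_pow_eq_one {G : Type*} [Group G] [Finite G] (n : ℕ) :
    n.gcd (Nat.card G) ∣ Nat.card {x : G // x ^ n = 1} := by
  induction hN : Nat.card G using Nat.strong_induction_on generalizing G n with
  | _ N IH =>
  subst hN
  classical
  have := Fintype.ofFinite G
  have hcard : ∀ k, Nat.card {x : G // x ^ k = 1} = #{x : G | x ^ k = 1} := fun k => by
    rw [Nat.card_eq_fintype_card, Fintype.card_subtype]
  -- Downward induction on the divisor `d`: the count for `d * p` is known, and the solutions lost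
  -- in passing to `d` are those whose `p`-part has the maximal order `p ^ (e + 1)`.
  have key : ∀ k d : ℕ, d * k = Nat.card G → d ∣ #{x : G | x ^ d = 1} := by
    intro k
    induction k using Nat.strong_induction_on with
    | _ k ihk =>
    intro d hd
    have hG : Nat.card G ≠ 0 := Nat.card_pos.ne'
    by_cases hk1 : k = 1
    · subst hk1
      rw [mul_one] at hd
      subst hd
      simp [Nat.card_eq_fintype_card]
    · obtain ⟨p, hp, l, rfl⟩ := Nat.exists_prime_and_dvd hk1
      have hd0 : d ≠ 0 := by rintro rfl; exact hG (by rw [← hd]; simp)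
      have hl0 : 0 < l := Nat.pos_of_ne_zero (by rintro rfl; exact hG (by rw [← hd]; simp))
      obtain ⟨e, r, hpr, rfl⟩ := Nat.exists_eq_pow_mul_and_not_dvd hd0 p hp.ne_one
      have hpr : p.Coprime r := (Nat.Prime.coprime_iff_not_dvd hp).2 hpr
      obtain ⟨u, hu1, hu0⟩ := Nat.chineseRemainder (hpr.pow_left (e + 1)) 1 0
      have hru : r ∣ u := (Nat.modEq_zero_iff_dvd).1 hu0
      have hbig : p ^ (e + 1) * r ∣ #{x : G | x ^ (p ^ (e + 1) * r) = 1} :=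
        ihk l (by nlinarith [hp.two_le]) _ (by rw [← hd]; ring)
      have hsplit := card_pow_eq_one_succ (G := G) hp hu1 hru
      refine (Nat.dvd_add_left (dvd_card_pow_eq_one_step hp hpr hu1 hru ?_)).1
        (hsplit ▸ (mul_dvd_mul_right (pow_dvd_pow p e.le_succ) r).trans hbig)
      intro y hy
      let y' : Subgroup.centralizer {y} := ⟨y, Subgroup.mem_centralizer_singleton_iff.2 rfl⟩
      have hy' : orderOf y' = p ^ (e + 1) := by rw [← hy]; exact Subgroup.orderOf_mk y _
      have hcomm : ∀ z, Commute y' z := fun z =>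
        Subtype.ext (Subgroup.mem_centralizer_singleton_iff.1 z.2).symm
      have : (Subgroup.zpowers y').Normal := by
        refine ⟨fun a ha z => ?_⟩
        obtain ⟨k, rfl⟩ := Subgroup.mem_zpowers_iff.1 ha
        rwa [((hcomm z).zpow_left k).symm.eq, mul_inv_cancel_right]
      have hq : Nat.card (Subgroup.centralizer {y} ⧸ Subgroup.zpowers y') * p ^ (e + 1) =
          Nat.card (Subgroup.centralizer {y}) := by
        rw [← hy', ← Nat.card_zpowers]
        exact (Subgroup.card_eq_card_quotient_mul_card_subgroup _).symm
      have hi : (Subgroup.centralizer {y}).index * Nat.card (Subgroup.centralizer {y}) =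
        Nat.card G := Subgroup.index_mul_card _
      have hq0 : 0 < Nat.card (Subgroup.centralizer {y} ⧸ Subgroup.zpowers y') := Nat.card_pos
      have hlt : Nat.card (Subgroup.centralizer {y} ⧸ Subgroup.zpowers y') < Nat.card G := by
        have h1 : 1 < p ^ (e + 1) := Nat.one_lt_pow (by omega) hp.one_lt
        calc _ < Nat.card (Subgroup.centralizer {y}) := by rw [← hq]; nlinarith
          _ ≤ Nat.card G := Subgroup.card_le_card_group _
      have hdiv := IH _ hlt (G := Subgroup.centralizer {y} ⧸ Subgroup.zpowers y') r rfl
      rw [card_pow_eq_one_quotient_zpowers hcomm (by rw [hy']; exact hpr.pow_left _)]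
      refine dvd_trans ?_ (mul_dvd_mul_left _ hdiv)
      -- `r` divides `index * |C(y)/⟨y⟩|`, because that number times `p ^ (e + 1)` is `|G|` and `r`
      -- is prime to `p`.
      rw [← Nat.gcd_mul_left]
      refine Nat.dvd_gcd (dvd_mul_left _ _) ?_
      refine (hpr.pow_left (e + 1)).symm.dvd_of_dvd_mul_right ?_
      rw [mul_assoc, hq, hi, ← hd]
      exact ⟨p ^ e * (p * l), by ring⟩
  obtain ⟨k, hk⟩ := Nat.gcd_dvd_right n (Nat.card G)
  have h := key k _ hk.symm
  have hset : ({x : G | x ^ n.gcd (Nat.card G) = 1} : Finset G) = ({x : G | x ^ n = 1} : Finset G) := by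
    ext x
    simp only [mem_filter, mem_univ, true_and, ← orderOf_dvd_iff_pow_eq_one, Nat.dvd_gcd_iff]
    exact and_iff_left (orderOf_dvd_natCard x)
  rw [hcard, ← hset]
  exact h

theorem le_card_pow_eq_one {G : Type*} [Group G] [Finite G] {d : ℕ} (hd : d ∣ Nat.card G) :
    d ≤ Nat.card {x : G // x ^ d = 1} := by
  have : Nonempty {x : G // x ^ d = 1} := ⟨⟨1, one_pow d⟩⟩
  have h := gcd_card_dvd_card_pow_eq_one (G := G) d
  rw [Nat.gcd_eq_left hd] at h
  exact Nat.le_of_dvd Nat.card_pos h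

end Frobenius

/-! ### Products of element orders and comparison with cyclic groups -/

section Rho

open Finset

theorem rho_eq_prod (G : Type*) [Group G] [Fintype G] : rho G = ∏ x : G, orderOf x :=
  finprod_eq_prod_of_fintype _

theorem rho_congr {G K : Type*} [Group G] [Group K] (e : G ≃* K) : rho G = rho K :=
  finprod_eq_of_bijective e e.bijective fun x => (e.orderOf_eq x).symm

theorem rho_prod (G K : Type*) [Group G] [Finite G] [Group K] [Finite K]
    (h : (Nat.card G).Coprime (Nat.card K)) :
    rho (G × K) = rho G ^ Nat.card K * rho K ^ Nat.card G := by
  have := Fintype.ofFinite G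
  have := Fintype.ofFinite K
  have ho : ∀ (a : G) (b : K), orderOf (a, b) = orderOf a * orderOf b := fun a b => by
    rw [Prod.orderOf]
    exact (Nat.Coprime.of_dvd (orderOf_dvd_natCard a) (orderOf_dvd_natCard b) h).lcm_eq_mul
  rw [rho_eq_prod, rho_eq_prod, rho_eq_prod, Fintype.prod_prod_type]
  simp only [ho, prod_mul_distrib, prod_const, card_univ, Nat.card_eq_fintype_card, prod_pow]

theorem rho_zmod_mul {m k : ℕ} [NeZero m] [NeZero k] (h : m.Coprime k) :
    rho (Multiplicative (ZMod (m * k))) =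
      rho (Multiplicative (ZMod m)) ^ k * rho (Multiplicative (ZMod k)) ^ m := by
  have hm : Nat.card (Multiplicative (ZMod m)) = m := by simp
  have hk : Nat.card (Multiplicative (ZMod k)) = k := by simp
  rw [rho_congr ((AddEquiv.toMultiplicative (ZMod.chineseRemainder h).toAddEquiv).trans
    (MulEquiv.prodMultiplicative _ _)), rho_prod _ _ (by rwa [hm, hk]), hm, hk]

theorem pow_card_sub_one_le_rho {G : Type*} [Group G] [Finite G] {q : ℕ}
    (hq : ∀ x : G, x ≠ 1 → q ≤ orderOf x) : q ^ (Nat.card G - 1) ≤ rho G := by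
  classical
  have := Fintype.ofFinite G
  rw [rho_eq_prod, ← mul_prod_erase univ _ (mem_univ 1), orderOf_one, one_mul,
    Nat.card_eq_fintype_card, ← card_univ, ← card_erase_of_mem (mem_univ (1 : G))]
  exact pow_card_le_prod _ _ _ fun x hx => hq x (ne_of_mem_erase hx)

/-- For `d = p ^ (k + 1)`, lower the `p`-part of `m` to `p ^ k`. -/
theorem exists_dvd_iff_not_primePow_dvd {d m : ℕ} (hm : m ≠ 0) (hd : IsPrimePow d) (hdm : d ∣ m) :
    ∃ e, e ∣ m ∧ ∀ o, o ∣ m → (o ∣ e ↔ ¬ d ∣ o) := by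
  obtain ⟨p, k, hp, hk, rfl⟩ := hd
  replace hp : p.Prime := hp.nat_prime
  obtain ⟨a, r, hpr, rfl⟩ := Nat.exists_eq_pow_mul_and_not_dvd hm p hp.ne_one
  obtain ⟨k, rfl⟩ := Nat.exists_eq_succ_of_ne_zero hk.ne'
  have hcop : p.Coprime r := (Nat.Prime.coprime_iff_not_dvd hp).2 hpr
  have hka : k + 1 ≤ a := (Nat.pow_dvd_pow_iff_le_right hp.one_lt).1
    ((hcop.pow_left _).dvd_of_dvd_mul_right hdm)
  refine ⟨p ^ k * r, mul_dvd_mul_right (pow_dvd_pow p (by omega)) r, fun o ho => ⟨?_, ?_⟩⟩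
  · intro h1 h2
    have h3 := h2.trans h1
    have h4 : p ^ (k + 1) ∣ p ^ k := (hcop.pow_left _).dvd_of_dvd_mul_right h3
    have := (Nat.pow_dvd_pow_iff_le_right hp.one_lt).1 h4
    omega
  · intro h
    have ho0 : o ≠ 0 := fun h0 => hm (zero_dvd_iff.1 (h0 ▸ ho))
    obtain ⟨j, s, hps, rfl⟩ := Nat.exists_eq_pow_mul_and_not_dvd ho0 p hp.ne_one
    have hs : p.Coprime s := (Nat.Prime.coprime_iff_not_dvd hp).2 hps
    have hj : j ≤ k := by
      by_contra hlt
      exact h ((pow_dvd_pow p (by omega)).trans (dvd_mul_right _ _))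
    exact mul_dvd_mul (pow_dvd_pow p hj)
      ((hs.pow_left a).symm.dvd_of_dvd_mul_left ((dvd_mul_left _ _).trans ho))

/-- Sum `log o = ∑ Λ(d)` over `d ∣ o` and interchange the sums. -/
theorem log_prod_orderOf {G : Type*} [Group G] [Finite G] {S : Finset G} {m : ℕ} (hm : m ≠ 0)
    (hS : ∀ x ∈ S, orderOf x ∣ m) :
    Real.log (∏ x ∈ S, orderOf x : ℕ) =
      ∑ d ∈ m.divisors, ArithmeticFunction.vonMangoldt d * #{x ∈ S | d ∣ orderOf x} := by
  rw [Nat.cast_prod, Real.log_prod (fun x _ => by exact_mod_cast (orderOf_pos x).ne')]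
  have h : ∀ x ∈ S, Real.log (orderOf x) =
      ∑ d ∈ m.divisors, if d ∣ orderOf x then ArithmeticFunction.vonMangoldt d else 0 := by
    intro x hx
    rw [← ArithmeticFunction.vonMangoldt_sum, ← sum_filter]
    refine sum_congr ?_ fun _ _ => rfl
    ext d
    simp only [Nat.mem_divisors, mem_filter]
    exact ⟨fun h => ⟨⟨h.1.trans (hS x hx), hm⟩, h.1⟩, fun h => ⟨h.2, (orderOf_pos x).ne'⟩⟩
  rw [sum_congr rfl h, sum_comm]
  refine sum_congr rfl fun d _ => ?_
  rw [← sum_filter, sum_const, nsmul_eq_mul, mul_comm]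

/-- Only prime powers `d` carry weight `Λ(d)`, and for these `d ∤ o(x)` means `o(x) ∣ e` for a fixed
`e ∣ m`. That holds for at least `e` elements of `S` but at most `e` of the cyclic group. -/
theorem prod_orderOf_le_rho_zmod {G : Type*} [Group G] [Finite G] {S : Finset G} {m : ℕ}
    (hm : m ≠ 0) (hS : ∀ x ∈ S, orderOf x ∣ m) (hcard : #S = m)
    (hle : ∀ d, d ∣ m → d ≤ #{x ∈ S | orderOf x ∣ d}) :
    ∏ x ∈ S, orderOf x ≤ rho (Multiplicative (ZMod m)) := by
  classical
  have : NeZero m := ⟨hm⟩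
  have hC : Fintype.card (Multiplicative (ZMod m)) = m := by simp [ZMod.card]
  have hC' : ∀ c : Multiplicative (ZMod m), orderOf c ∣ m := fun c => by
    simpa [hC] using orderOf_dvd_card (x := c)
  have hpos : 0 < ∏ x ∈ S, orderOf x := prod_pos fun x _ => orderOf_pos x
  have hpos' : 0 < ∏ c : Multiplicative (ZMod m), orderOf c := prod_pos fun x _ => orderOf_pos x
  rw [rho_eq_prod, ← Nat.cast_le (α := ℝ), ← Real.log_le_log_iff (by exact_mod_cast hpos)
    (by exact_mod_cast hpos'), log_prod_orderOf hm hS, log_prod_orderOf hm fun c _ => hC' c]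
  refine sum_le_sum fun d hd => ?_
  by_cases hdp : IsPrimePow d
  · refine mul_le_mul_of_nonneg_left ?_ ArithmeticFunction.vonMangoldt_nonneg
    rw [Nat.cast_le]
    obtain ⟨e, hem, he⟩ := exists_dvd_iff_not_primePow_dvd hm hdp (Nat.dvd_of_mem_divisors hd)
    have h1 : #{x ∈ S | d ∣ orderOf x} + #{x ∈ S | orderOf x ∣ e} = m := by
      rw [← hcard, ← card_filter_add_card_filter_not (s := S) (fun x => d ∣ orderOf x)]
      congr 2
      exact filter_congr fun x hx => he _ (hS x hx)
    have h2 : #{c : Multiplicative (ZMod m) | d ∣ orderOf c} +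
        #{c : Multiplicative (ZMod m) | orderOf c ∣ e} = m := by
      conv_rhs => rw [← hC, ← card_univ, ← card_filter_add_card_filter_not
        (s := (univ : Finset (Multiplicative (ZMod m)))) (fun x => d ∣ orderOf x)]
      congr 2
      exact filter_congr fun x _ => he _ (hC' x)
    have h3 : #{c : Multiplicative (ZMod m) | orderOf c ∣ e} ≤ e := by
      simp only [orderOf_dvd_iff_pow_eq_one]
      exact IsCyclic.card_pow_eq_one_le (Nat.pos_of_dvd_of_pos hem (Nat.pos_of_ne_zero hm))
    have := hle e hem
    omega
  · rw [ArithmeticFunction.vonMangoldt_eq_zero_iff.2 hdp, zero_mul, zero_mul]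

theorem rho_le_rho_zmod (G : Type*) [Group G] [Finite G] :
    rho G ≤ rho (Multiplicative (ZMod (Nat.card G))) := by
  have := Fintype.ofFinite G
  rw [rho_eq_prod]
  refine prod_orderOf_le_rho_zmod Nat.card_pos.ne' (fun x _ => orderOf_dvd_natCard x)
    (by simp [Nat.card_eq_fintype_card]) fun d hd => (le_card_pow_eq_one hd).trans_eq ?_
  classical
  simp only [← orderOf_dvd_iff_pow_eq_one]
  rw [Nat.card_eq_fintype_card, Fintype.card_subtype]

end Rho

/-! ### Frobenius complements and their kernels -/

namespace IsFrobeniusComplement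

open Finset

variable {G : Type*} [Group G] {H : Subgroup G}

theorem mem_of_conj_mem (hH : IsFrobeniusComplement H) {h x : G} (hh : h ∈ H) (h1 : h ≠ 1)
    (hx : x * h * x⁻¹ ∈ H) : x ∈ H := by
  by_contra hxH
  have hmem : x * h * x⁻¹ ∈ H ⊓ H.map (MulAut.conj x⁻¹⁻¹).toMonoidHom :=
    ⟨hx, h, hh, by simp⟩
  rw [hH.inf_conj_eq_bot x⁻¹ (fun h => hxH (inv_mem_iff.1 h)), Subgroup.mem_bot,
    conj_eq_one_iff] at hmem
  exact h1 hmem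

theorem mem_of_commute (hH : IsFrobeniusComplement H) {h x : G} (hh : h ∈ H) (h1 : h ≠ 1)
    (hx : Commute x h) : x ∈ H :=
  hH.mem_of_conj_mem hh h1 (by rwa [hx.eq, mul_inv_cancel_right])

theorem _root_.mem_frobeniusKernel {x : G} :
    x ∈ frobeniusKernel H ↔ ∀ g : G, g * x * g⁻¹ ∈ H → x = 1 := by
  simp only [frobeniusKernel, Set.mem_sdiff, Set.mem_univ, true_and, Set.mem_iUnion, not_exists,
    Set.mem_image, not_and, SetLike.mem_coe, Set.mem_singleton_iff]
  constructor
  · intro h g hg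
    by_contra hx
    exact h g (g * x * g⁻¹) ⟨hg, fun h' => hx (conj_eq_one_iff.1 h')⟩ (by group)
  · rintro h g k ⟨hk, hk1⟩ rfl
    have := h g (by rwa [show g * (g⁻¹ * k * g) * g⁻¹ = k by group])
    have h2 : g⁻¹ * k * g⁻¹⁻¹ = 1 := by rwa [inv_inv]
    exact hk1 (conj_eq_one_iff.1 h2)

theorem bijOn_conj_out (hH : IsFrobeniusComplement H) :
    Set.BijOn (fun a : (G ⧸ H) × H => a.1.out * a.2 * a.1.out⁻¹) {a | a.2 ≠ 1}
      (frobeniusKernel H)ᶜ := by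
  refine ⟨?_, ?_, ?_⟩
  · rintro ⟨q, h⟩ hh hmem
    have h1 := mem_frobeniusKernel.1 hmem q.out⁻¹ (by
      rw [show q.out⁻¹ * (q.out * (h : G) * q.out⁻¹) * q.out⁻¹⁻¹ = h by group]
      exact h.2)
    exact hh (Subtype.ext (conj_eq_one_iff.1 h1))
  · rintro ⟨q, h⟩ hh ⟨q', h'⟩ hh' heq
    change q.out * (h : G) * q.out⁻¹ = q'.out * (h' : G) * q'.out⁻¹ at heq
    have hmem : q'.out⁻¹ * q.out ∈ H := by
      refine hH.mem_of_conj_mem h.2 (fun h0 => hh (Subtype.ext h0)) ?_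
      rw [show q'.out⁻¹ * q.out * (h : G) * (q'.out⁻¹ * q.out)⁻¹ =
        q'.out⁻¹ * (q.out * (h : G) * q.out⁻¹) * q'.out by group, heq,
        show q'.out⁻¹ * (q'.out * (h' : G) * q'.out⁻¹) * q'.out = h' by group]
      exact h'.2
    have hq : q' = q := by
      rw [← q'.out_eq', ← q.out_eq']
      exact QuotientGroup.eq.2 hmem
    subst hq
    have hhh : (h : G) = h' := by simpa using heq
    rw [Subtype.ext hhh]
  · intro x hx
    obtain ⟨g, hg, hx1⟩ : ∃ g : G, g * x * g⁻¹ ∈ H ∧ x ≠ 1 := by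
      simpa [mem_frobeniusKernel] using hx
    -- The chosen representative is `g⁻¹ * k` with `k ∈ H`, so the element of `H` must be conjugated
    -- by `k` to compensate.
    obtain ⟨k, hk⟩ := QuotientGroup.mk_out_eq_mul H g⁻¹
    refine ⟨(QuotientGroup.mk g⁻¹, k⁻¹ * ⟨_, hg⟩ * k), ?_, ?_⟩
    · intro h0
      have h1 : k⁻¹ * (⟨_, hg⟩ : H) * k⁻¹⁻¹ = 1 := by rwa [inv_inv]
      exact hx1 (conj_eq_one_iff.1 (congrArg Subtype.val (conj_eq_one_iff.1 h1)))
    · change Quotient.out (QuotientGroup.mk g⁻¹ : G ⧸ H) *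
        ((k : G)⁻¹ * (g * x * g⁻¹) * k) * (Quotient.out (QuotientGroup.mk g⁻¹ : G ⧸ H))⁻¹ = x
      rw [hk]
      group

variable [Finite G]

theorem card_frobeniusKernel (hH : IsFrobeniusComplement H) :
    (frobeniusKernel H).ncard = H.index := by
  classical
  have h1 : ({a : (G ⧸ H) × H | a.2 ≠ 1}).ncard = H.index * (Nat.card H - 1) := by
    have : ({a : (G ⧸ H) × H | a.2 ≠ 1}) = Set.univ ×ˢ ({1}ᶜ : Set H) := by
      ext a; simp
    rw [this, Set.ncard_prod, Set.ncard_univ, Set.ncard_compl, Set.ncard_singleton]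
    rfl
  have h2 := Set.ncard_add_ncard_compl (frobeniusKernel H)
  rw [← hH.bijOn_conj_out.image_eq, hH.bijOn_conj_out.injOn.ncard_image, h1,
    ← H.index_mul_card, Nat.mul_sub, mul_one] at h2
  have h3 : H.index ≤ H.index * Nat.card H := Nat.le_mul_of_pos_right _ Nat.card_pos
  omega

theorem rho_eq (hH : IsFrobeniusComplement H) :
    rho G = (∏ᶠ x ∈ frobeniusKernel H, orderOf x) * rho H ^ H.index := by
  classical
  have := Fintype.ofFinite G
  have h1 : ∏ᶠ x ∈ frobeniusKernel H, orderOf x = ∏ x : G with x ∈ frobeniusKernel H, orderOf x := by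
    rw [← finprod_mem_coe_finset]
    simp
  have h2 : ∏ x : G with x ∉ frobeniusKernel H, orderOf x =
      ∏ a : (G ⧸ H) × H with a.2 ≠ 1, orderOf a.2 := by
    symm
    have hb := hH.bijOn_conj_out
    refine prod_nbij (fun a => a.1.out * a.2 * a.1.out⁻¹) (fun a ha => ?_) ?_ ?_ fun a _ => ?_
    · simpa using hb.mapsTo (by simpa using ha)
    · simpa using hb.injOn
    · intro x hx
      simpa using hb.surjOn (by simpa using hx)
    · rw [← Subgroup.orderOf_coe]
      exact ((MulAut.conj a.1.out).orderOf_eq (a.2 : G)).symm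
  have h3 : ∏ a : (G ⧸ H) × H with a.2 ≠ 1, orderOf a.2 = rho H ^ H.index := by
    rw [rho_eq_prod, Subgroup.index, Nat.card_eq_fintype_card, ← card_univ, ← prod_const,
      prod_filter_of_ne, Fintype.prod_prod_type]
    rintro a - ha h0
    exact ha (by rw [h0, orderOf_one])
  rw [rho_eq_prod, h1, ← h3, ← h2, prod_filter_mul_prod_filter_not]

/-- Let a Sylow subgroup `Q` contain some `h ∈ H` of order `p`. A nontrivial central `z` of `Q`
commutes with `h`, so it lies in `H`; all of `Q` commutes with `z`, so `Q ≤ H`. -/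
theorem exists_sylow_le (hH : IsFrobeniusComplement H) {p : ℕ} [Fact p.Prime]
    (hp : p ∣ Nat.card H) : ∃ Q : Sylow p G, (Q : Subgroup G) ≤ H := by
  obtain ⟨h, hh⟩ := exists_prime_orderOf_dvd_card' p hp
  have hh1 : (h : G) ≠ 1 := fun h0 => by
    rw [← Subgroup.orderOf_coe, h0, orderOf_one] at hh
    exact (Fact.out : p.Prime).one_lt.ne hh
  have hpg : IsPGroup p (Subgroup.zpowers (h : G)) := by
    refine IsPGroup.of_card (n := 1) ?_
    rw [Nat.card_zpowers, Subgroup.orderOf_coe, hh, pow_one]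
  obtain ⟨Q, hQ⟩ := hpg.exists_le_sylow
  have hhQ : (h : G) ∈ (Q : Subgroup G) := hQ (Subgroup.mem_zpowers _)
  have : Nontrivial (Q : Subgroup G) :=
    (Subgroup.nontrivial_iff_exists_ne_one _).2 ⟨h, hhQ, hh1⟩
  have := Q.isPGroup'.center_nontrivial
  obtain ⟨⟨z, hz⟩, hz1⟩ := exists_ne (1 : Subgroup.center (Q : Subgroup G))
  have hcomm : ∀ w ∈ (Q : Subgroup G), Commute w z := fun w hw =>
    congrArg Subtype.val (Subgroup.mem_center_iff.1 hz ⟨w, hw⟩)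
  have hzH : (z : G) ∈ H := hH.mem_of_commute h.2 hh1 (hcomm h hhQ).symm
  exact ⟨Q, fun w hw => hH.mem_of_commute hzH
    (fun h0 => hz1 (Subtype.ext (Subtype.ext h0))) (hcomm w hw)⟩

theorem coprime_index (hH : IsFrobeniusComplement H) : H.index.Coprime (Nat.card H) := by
  refine Nat.coprime_of_dvd fun p hp hpi hpH => ?_
  have := Fact.mk hp
  obtain ⟨Q, hQ⟩ := hH.exists_sylow_le hpH
  exact Q.not_dvd_index (hpi.trans (Subgroup.index_dvd_of_le hQ))

theorem mem_frobeniusKernel_iff (hH : IsFrobeniusComplement H) {x : G} :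
    x ∈ frobeniusKernel H ↔ orderOf x ∣ H.index := by
  constructor
  · intro hx
    -- Otherwise a power of `x` of prime order is conjugate into `H`; the same conjugate of `x`
    -- commutes with it, hence lies in `H`, forcing `x = 1`.
    have hcop : (orderOf x).Coprime (Nat.card H) := by
      refine Nat.coprime_of_dvd fun p hp hpx hpH => ?_
      have := Fact.mk hp
      obtain ⟨Q, hQ⟩ := hH.exists_sylow_le hpH
      obtain ⟨k, hk⟩ := hpx
      have hk0 : k ≠ 0 := by rintro rfl; exact (orderOf_pos x).ne' (by simpa using hk)
      have ho : orderOf (x ^ k) = p := by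
        rw [orderOf_pow_of_dvd hk0 (hk ▸ dvd_mul_left _ _), hk,
          Nat.mul_div_cancel _ (Nat.pos_of_ne_zero hk0)]
      have hpg : IsPGroup p (Subgroup.zpowers (x ^ k)) :=
        IsPGroup.of_card (n := 1) (by rw [Nat.card_zpowers, ho, pow_one])
      obtain ⟨P, hP⟩ := hpg.exists_le_sylow
      obtain ⟨g, rfl⟩ := MulAction.exists_smul_eq G P Q
      have hmem : g * x ^ k * g⁻¹ ∈ H := by
        refine hQ ?_
        rw [Sylow.coe_subgroup_smul]
        exact Subgroup.smul_mem_pointwise_smul (x ^ k) (MulAut.conj g) _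
          (hP (Subgroup.mem_zpowers _))
      have hne : g * x ^ k * g⁻¹ ≠ 1 := fun h0 => by
        rw [conj_eq_one_iff.1 h0, orderOf_one] at ho
        exact hp.one_lt.ne ho
      have hx1 : x = 1 := mem_frobeniusKernel.1 hx g (hH.mem_of_commute hmem hne (by
        rw [← conj_pow]
        exact (Commute.refl _).pow_right k))
      rw [hx1, orderOf_one] at hk
      exact hp.one_lt.ne' (Nat.dvd_one.1 ⟨k, hk⟩)
    refine hcop.dvd_of_dvd_mul_right ?_
    rw [H.index_mul_card]
    exact orderOf_dvd_natCard x
  · intro hx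
    refine mem_frobeniusKernel.2 fun g hg => ?_
    have h1 : orderOf x ∣ Nat.card H := by
      have := Subgroup.orderOf_dvd_natCard H hg
      rwa [show orderOf (g * x * g⁻¹) = orderOf x from (MulAut.conj g).orderOf_eq x] at this
    rw [← orderOf_eq_one_iff]
    exact Nat.dvd_one.1 (hH.coprime_index ▸ Nat.dvd_gcd hx h1)

theorem finprod_frobeniusKernel_le (hH : IsFrobeniusComplement H) :
    ∏ᶠ x ∈ frobeniusKernel H, orderOf x ≤ rho (Multiplicative (ZMod H.index)) := by
  classical
  have := Fintype.ofFinite G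
  have hset : frobeniusKernel H = (({x : G | orderOf x ∣ H.index} : Finset G) : Set G) := by
    ext x
    simpa using hH.mem_frobeniusKernel_iff
  have hcard := hH.card_frobeniusKernel
  rw [hset, Set.ncard_coe_finset] at hcard
  rw [hset, finprod_mem_coe_finset]
  refine prod_orderOf_le_rho_zmod Subgroup.FiniteIndex.index_ne_zero
    (fun x hx => (mem_filter.1 hx).2) hcard fun d hd => ?_
  refine (le_card_pow_eq_one (G := G) (hd.trans H.index_dvd_card)).trans_eq ?_
  simp only [← orderOf_dvd_iff_pow_eq_one]
  rw [Nat.card_eq_fintype_card, Fintype.card_subtype, filter_filter]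
  congr 1
  ext x
  simpa using fun h : orderOf x ∣ d => h.trans hd

theorem rho_mul_minFac_pow_le (hH : IsFrobeniusComplement H) :
    rho G * (Nat.card G).minFac ^ (Nat.card G).minFac ≤
      rho (Multiplicative (ZMod (Nat.card G))) := by
  set q := (Nat.card G).minFac with hq
  have hm0 : H.index ≠ 0 := Subgroup.FiniteIndex.index_ne_zero
  have : NeZero H.index := ⟨hm0⟩
  have : NeZero (Nat.card H) := ⟨Nat.card_pos.ne'⟩
  have hqle : ∀ d, d ∣ Nat.card G → d ≠ 1 → q ≤ d := fun d hd hd1 =>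
    (Nat.minFac_le_of_dvd (by
      have : d ≠ 0 := fun h0 => Nat.card_pos.ne' (zero_dvd_iff.1 (h0 ▸ hd))
      omega) hd)
  have hm : q ≤ H.index :=
    hqle _ H.index_dvd_card fun h => hH.ne_top (Subgroup.index_eq_one.1 h)
  have hh : q ≤ Nat.card H :=
    hqle _ H.card_subgroup_dvd_card fun h => hH.ne_bot (Subgroup.card_eq_one.1 h)
  have hq2 : 2 ≤ q := by
    refine (Nat.minFac_prime fun h => ?_).two_le
    have := H.card_subgroup_dvd_card
    rw [h, Nat.dvd_one] at this
    exact hH.ne_bot (Subgroup.card_eq_one.1 this)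
  have hne : H.index ≠ Nat.card H := fun h => by
    have := hH.coprime_index
    rw [h, Nat.coprime_self] at this
    omega
  have hlow : q ^ (H.index - 1) ≤ rho (Multiplicative (ZMod H.index)) := by
    have := pow_card_sub_one_le_rho (G := Multiplicative (ZMod H.index)) (q := q) fun x hx =>
      hqle _ (by
        have h1 := orderOf_dvd_natCard x
        rw [show Nat.card (Multiplicative (ZMod H.index)) = H.index by simp] at h1
        exact h1.trans H.index_dvd_card) (by rwa [Ne, orderOf_eq_one_iff])
    simpa using this
  -- Both numbers are at least `q ≥ 2` and they differ, so the larger one minus 1 is at least `q`.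
  have hexp : q ≤ (H.index - 1) * (Nat.card H - 1) := by
    rcases Nat.lt_or_gt_of_ne hne with h | h
    · calc q = 1 * q := (one_mul q).symm
        _ ≤ _ := Nat.mul_le_mul (by omega) (by omega)
    · calc q = q * 1 := (mul_one q).symm
        _ ≤ _ := Nat.mul_le_mul (by omega) (by omega)
  have hpow : q ^ q ≤ rho (Multiplicative (ZMod H.index)) ^ (Nat.card H - 1) :=
    calc q ^ q ≤ q ^ ((H.index - 1) * (Nat.card H - 1)) := Nat.pow_le_pow_right (by omega) hexp
      _ = (q ^ (H.index - 1)) ^ (Nat.card H - 1) := pow_mul _ _ _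
      _ ≤ _ := Nat.pow_le_pow_left hlow _
  calc rho G * q ^ q
      ≤ (rho (Multiplicative (ZMod H.index)) * rho (Multiplicative (ZMod (Nat.card H))) ^ H.index)
        * rho (Multiplicative (ZMod H.index)) ^ (Nat.card H - 1) := by
        rw [hH.rho_eq]
        gcongr
        · exact hH.finprod_frobeniusKernel_le
        · exact rho_le_rho_zmod H
    _ = rho (Multiplicative (ZMod (H.index * Nat.card H))) := by
        rw [rho_zmod_mul hH.coprime_index, mul_right_comm, ← pow_succ',
          Nat.sub_add_cancel (by omega)]
    _ = rho (Multiplicative (ZMod (Nat.card G))) := by rw [H.index_mul_card]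

end IsFrobeniusComplement

theorem proposition4p1 {G : Type*} [Group G] [Finite G] (H : Subgroup G)
    (hH : IsFrobeniusComplement H) :
    -- the product formula, with the kernel as a set (not presupposing that it is a subgroup)
    rho G = (∏ᶠ x ∈ frobeniusKernel H, orderOf x) * rho H ^ (frobeniusKernel H).ncard ∧
    -- the product formula, with the kernel as a subgroup `N`
    (∀ N : Subgroup G, (N : Set G) = frobeniusKernel H →
      rho G = rho N * rho H ^ Nat.card N) ∧
    -- the bound; `(Nat.card G).minFac` is the smallest prime dividing the order of `G`
    (rho G : ℝ) ≤ ((Nat.card G).minFac : ℝ) ^ (-((Nat.card G).minFac : ℤ)) *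
      (rho (Multiplicative (ZMod (Nat.card G))) : ℝ) := by
  have hprod := hH.rho_eq
  rw [← hH.card_frobeniusKernel] at hprod
  refine ⟨hprod, fun N hN => ?_, ?_⟩
  · rw [hprod, ← hN, ← Nat.card_coe_set_eq]
    congr 1
    rw [← finprod_set_coe_eq_finprod_mem]
    exact finprod_congr fun x => Subgroup.orderOf_coe x
  · have hpos : (0 : ℝ) < ((Nat.card G).minFac : ℝ) ^ (Nat.card G).minFac := by
      have := (Nat.card G).minFac_pos
      positivity
    rw [zpow_neg, zpow_natCast, inv_mul_eq_div, le_div_iff₀ hpos]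
    exact_mod_cast hH.rho_mul_minFac_pow_le
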